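/- Let $\alpha=(\alpha_1,\dots,\alpha_{n_0})$, $n_0\ge 1$, be a list of complex numbers (the roots, repetitions allowed) such that $\alpha_n-\alpha_m\neq 2k\pi\mathrm{i}$ for all $k\in\mathbb{Z}$ and every pair $\alpha_n\neq\alpha_m$ of distinct roots that are purely imaginary (real part zero). Let $\beta^+_\alpha$ be the causal exponential B-spline with roots $\alpha$, i.e. the function with Fourier transform $$\int_{\mathbb{R}}\beta^+_\alpha(t)\,\mathrm{e}^{-\mathrm{i}\omega t}\,\mathrm{d}t=\prod_{n=1}^{n_0}\frac{1-\mathrm{e}^{\alpha_n-\mathrm{i}\omega}}{\mathrm{i}\omega-\alpha_n},$$ equivalently the convolution $\beta^+_{\alpha_1}*\cdots*\beta^+_{\alpha_{n_0}}$ with $\beta^+_{a}(t)=\mathrm{e}^{at}$ for $t\in[0,1)$ and $\beta^+_a(t)=0$ otherwise. Let $\beta_\alpha(t)=\beta^+_\alpha(t+n_0/2)$ be its centered version. For $\lambda\in\ell_1(\mathbb{Z})$ put $$\phi_{\lambda,\alpha}(t)=\sum_{n\in\mathbb{Z}}\lambda[n]\,\beta_\alpha\!\left(t-\tfrac n2\right),\qquad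 t\in\mathbb{R}.$$ For every $\lambda\in\ell_1(\mathbb{Z})$, if $\phi_{\lambda,\alpha}$ is interpolatory, that is, $\phi_{\lambda,\alpha}(0)=1$ and $\phi_{\lambda,\alpha}(k)=0$ for every nonzero integer $k$, then the family $\{\phi_{\lambda,\alpha}(\cdot-n)\}_{n\in\mathbb{Z}}$ is a Riesz basis: its members lie in $L_2(\mathbb{R})$, and there are constants $A,B>0$ such that for every $c\in\ell_2(\mathbb{Z})$ the series $\sum_{n\in\mathbb{Z}}c[n]\,\phi_{\lambda,\alpha}(\cdot-n)$ converges in $L_2(\mathbb{R})$ and $$A\,\|c\|_{\ell_2(\mathbb{Z})}\le\Big\|\sum_{n\in\mathbb{Z}}c[n]\,\phi_{\lambda,\alpha}(\cdot-n)\Big\|_{L_2(\mathbb{R})}\le B\,\|c\|_{\ell_2(\mathbb{Z})}.$$ -/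

import Mathlib

open MeasureTheory

noncomputable section

/-- The exponential B-spline with the single root `a`: `t ↦ exp (a t)` on `[0, 1)`, zero elsewhere. -/
def expBSplineOne (a : ℂ) : ℝ → ℂ :=
  Set.indicator (Set.Ico (0 : ℝ) 1) (fun t : ℝ => Complex.exp (a * (t : ℂ)))

/-- The causal exponential B-spline with the list of roots `α = (α₁, …, α_{n₀})`, `n₀ ≥ 1`: the
convolution of the B-splines of the individual roots. Its Fourier transform is computed in
`fourier_causalExpBSpline`. The value at the empty list is irrelevant. -/
def causalExpBSpline : List ℂ → ℝ → ℂ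
  | [] => 0
  | [a] => expBSplineOne a
  | a :: b :: l =>
      convolution (expBSplineOne a) (causalExpBSpline (b :: l))
        (ContinuousLinearMap.mul ℂ ℂ) volume

/-- The centered exponential B-spline `β_α(t) = β_α⁺(t + n₀/2)`. -/
def expBSpline (α : List ℂ) (t : ℝ) : ℂ :=
  causalExpBSpline α (t + (α.length : ℝ) / 2)

/-- The generator `φ_{λ,α}(t) = ∑ₙ λ[n] β_α(t - n/2)`. -/
def generator (lam : ℤ → ℂ) (α : List ℂ) (t : ℝ) : ℂ :=
  ∑' n : ℤ, lam n * expBSpline α (t - (n : ℝ) / 2)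

/-- The interpolation condition: `φ(k) = δ[k]` for every integer `k`. -/
def IsInterpolatory (φ : ℝ → ℂ) : Prop :=
  ∀ k : ℤ, φ (k : ℝ) = if k = 0 then 1 else 0

/-- A family `(φₙ)` of functions on the line is a Riesz basis (of the closed subspace of `L₂(ℝ)`
that it generates) if its members are in `L₂(ℝ)` and there are constants `A, B > 0` such that for
every `c ∈ ℓ₂(ℤ)` the series `∑ₙ c[n] φₙ` converges in `L₂(ℝ)` and
`A ‖c‖ ≤ ‖∑ₙ c[n] φₙ‖ ≤ B ‖c‖`. -/
def IsRieszBasis (φ : ℤ → ℝ → ℂ) : Prop :=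
  ∃ h : ∀ n : ℤ, MemLp (φ n) 2 (volume : Measure ℝ),
    ∃ A B : ℝ, 0 < A ∧ 0 < B ∧
      ∀ c : lp (fun _ : ℤ => ℂ) 2, ∃ s : Lp ℂ 2 (volume : Measure ℝ),
        HasSum (fun n : ℤ => c n • (h n).toLp (φ n)) s ∧
          A * ‖c‖ ≤ ‖s‖ ∧ ‖s‖ ≤ B * ‖c‖

lemma integrable_expBSplineOne (a : ℂ) : Integrable (expBSplineOne a) := by
  have hc : Continuous (fun t : ℝ => Complex.exp (a * (t : ℂ))) := by fun_prop
  unfold expBSplineOne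
  rw [integrable_indicator_iff measurableSet_Ico]
  exact (hc.integrableOn_Icc (a := 0) (b := 1)).mono_set Set.Ico_subset_Icc_self

lemma integrable_causalExpBSpline (α : List ℂ) : Integrable (causalExpBSpline α) := by
  induction α using causalExpBSpline.induct with
  | case1 => exact integrable_zero _ _ _
  | case2 a => exact integrable_expBSplineOne a
  | case3 a b l ih => exact (integrable_expBSplineOne a).integrable_convolution _ ih

lemma fourier_expBSplineOne (a : ℂ) (ω : ℝ) :
    ∫ t : ℝ, Complex.exp (-(Complex.I * ω * t)) * expBSplineOne a t =
      if Complex.I * ω = a then 1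
      else (1 - Complex.exp (a - Complex.I * ω)) / (Complex.I * ω - a) := by
  have h1 : ∀ t : ℝ, Complex.exp (-(Complex.I * ω * t)) * expBSplineOne a t =
      Set.indicator (Set.Ico (0 : ℝ) 1)
        (fun t : ℝ => Complex.exp ((a - Complex.I * ω) * (t : ℂ))) t := by
    intro t
    unfold expBSplineOne
    by_cases ht : t ∈ Set.Ico (0 : ℝ) 1
    · rw [Set.indicator_of_mem ht, Set.indicator_of_mem ht, ← Complex.exp_add]
      congr 1
      ring
    · rw [Set.indicator_of_notMem ht, Set.indicator_of_notMem ht, mul_zero]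
  simp_rw [h1]
  rw [integral_indicator measurableSet_Ico, integral_Ico_eq_integral_Ioc,
    ← intervalIntegral.integral_of_le zero_le_one]
  split_ifs with h
  · simp [h]
  · have h2 : a - Complex.I * ω ≠ 0 := fun h' => h (sub_eq_zero.mp h').symm
    have h3 : Complex.I * ω - a ≠ 0 := fun h' => h (sub_eq_zero.mp h')
    rw [integral_exp_mul_complex h2]
    rw [div_eq_div_iff h2 h3]
    simp
    ring

/-- The Fourier transform of the causal exponential B-spline is
`∏ₙ (1 - exp (αₙ - i ω)) / (i ω - αₙ)`, a factor being `1` where `i ω = αₙ`. -/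
lemma fourier_causalExpBSpline (α : List ℂ) (hα : α ≠ []) (ω : ℝ) :
    ∫ t : ℝ, Complex.exp (-(Complex.I * ω * t)) * causalExpBSpline α t =
      (α.map fun a => if Complex.I * ω = a then (1 : ℂ)
        else (1 - Complex.exp (a - Complex.I * ω)) / (Complex.I * ω - a)).prod := by
  have mod : ∀ f : ℝ → ℂ, Integrable f →
      Integrable (fun t : ℝ => Complex.exp (-(Complex.I * ω * t)) * f t) := by
    intro f hf
    refine hf.bdd_mul (c := 1) (Continuous.aestronglyMeasurable (by fun_prop)) ?_
    refine Filter.Eventually.of_forall fun t => le_of_eq ?_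
    rw [Complex.norm_exp]
    simp
  induction α using causalExpBSpline.induct with
  | case1 => exact absurd rfl hα
  | case2 a => simpa [causalExpBSpline] using fourier_expBSplineOne a ω
  | case3 a b l ih =>
    have key : ∀ t : ℝ, Complex.exp (-(Complex.I * ω * t)) * causalExpBSpline (a :: b :: l) t =
        convolution (fun t : ℝ => Complex.exp (-(Complex.I * ω * t)) * expBSplineOne a t)
          (fun t : ℝ => Complex.exp (-(Complex.I * ω * t)) * causalExpBSpline (b :: l) t)
          (ContinuousLinearMap.mul ℂ ℂ) volume t := by
      intro t
      simp only [causalExpBSpline, convolution, ContinuousLinearMap.mul_apply']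
      rw [← integral_const_mul]
      congr 1
      funext u
      have : Complex.exp (-(Complex.I * ω * t)) =
          Complex.exp (-(Complex.I * ω * u)) * Complex.exp (-(Complex.I * ω * (t - u : ℝ))) := by
        rw [← Complex.exp_add]
        congr 1
        push_cast
        ring
      rw [this]
      ring
    simp_rw [key]
    rw [integral_convolution _ (mod _ (integrable_expBSplineOne a))
      (mod _ (integrable_causalExpBSpline (b :: l))), ih (by simp), fourier_expBSplineOne]
    rw [List.map_cons, List.prod_cons]
    rfl

end

/-!
The integer translates of an interpolatory generator `φ` form a Riesz basis because the coefficients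
of `f = ∑ₙ c[n] φ(· - n)` are its samples, `f(k) = c[k]`, and sampling is a bounded operation on the
functions `f` that arise. No Fourier analysis is needed.

Lower bound. Being a convolution of indicators of half-open intervals weighted by exponentials,
`β = β_α` is bounded, compactly supported and right-continuous everywhere
(`exists_isRightContinuousBump_expBSpline`). Hence on each interval `[k, k + 1)` the function `φ`,
and with it every finite combination `f`, is a linear combination of the same finitely many
functions `β (· + j / 2)` (`IsRightContinuousBump.exists_mem_span_eqOn`). On their span the
`L²`-norm over `[0, 1)` controls the value at `0`: a right-continuous function that vanishes almost
everywhere on `[0, 1)` vanishes at `0`, and the span is finite-dimensional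
(`exists_enorm_apply_zero_sq_le`). So `|c[k]|² ≤ C ∫_{[k, k+1)} |f|²` with `C` independent of `k`,
and summing over `k` gives `‖c‖² ≤ C ‖f‖²` (`sum_enorm_sq_le_lintegral`).

Upper bound. Since `λ ∈ ℓ₁` and `β` has compact support, `∑ₙ |φ(t - n)|` is bounded uniformly in `t`
(`IsRightContinuousBump.sum_norm_tsum_le`), and `φ` is integrable; the Cauchy-Schwarz inequality
does the rest (`lintegral_enorm_sum_sq_le`).

Both bounds are proved for finite combinations and pass to `ℓ₂` by completeness
(`exists_hasSum_and_norm_le`).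
-/

/-! ### Right-continuous functions with compact support -/

/-- Dominated convergence: convolving a bounded, everywhere right-continuous function with an
integrable one keeps right-continuity. -/
lemma continuousWithinAt_Ici_convolution {f h : ℝ → ℂ} {M : ℝ} (hf : Integrable f)
    (hh : AEStronglyMeasurable h) (hM : ∀ t, ‖h t‖ ≤ M)
    (hr : ∀ t, ContinuousWithinAt h (Set.Ici t) t) (t : ℝ) :
    ContinuousWithinAt (convolution f h (ContinuousLinearMap.mul ℂ ℂ) volume) (Set.Ici t) t := by
  change Filter.Tendsto (fun s => ∫ u, f u * h (s - u)) (nhdsWithin t (Set.Ici t))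
    (nhds (∫ u, f u * h (t - u)))
  refine tendsto_integral_filter_of_dominated_convergence (fun u => ‖f u‖ * M) ?_ ?_
    (hf.norm.mul_const M) ?_
  · refine Filter.Eventually.of_forall fun s => hf.aestronglyMeasurable.mul ?_
    exact hh.comp_measurePreserving (Measure.measurePreserving_sub_left volume s)
  · refine Filter.Eventually.of_forall fun s => Filter.Eventually.of_forall fun u => ?_
    rw [norm_mul]
    exact mul_le_mul_of_nonneg_left (hM _) (norm_nonneg _)
  · refine Filter.Eventually.of_forall fun u => Filter.Tendsto.const_mul _ ?_
    exact (hr (t - u)).comp (f := fun s : ℝ => s - u) (s := Set.Ici t) (by fun_prop)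
      fun s hs => sub_le_sub_right (Set.mem_Ici.1 hs) u

lemma norm_convolution_mul_le {f h : ℝ → ℂ} {M : ℝ} (hf : Integrable f)
    (hM : ∀ t, ‖h t‖ ≤ M) (t : ℝ) :
    ‖convolution f h (ContinuousLinearMap.mul ℂ ℂ) volume t‖ ≤ (∫ u, ‖f u‖) * M := by
  simp only [convolution, ContinuousLinearMap.mul_apply']
  rw [← integral_mul_const]
  refine norm_integral_le_of_norm_le (hf.norm.mul_const M) (Filter.Eventually.of_forall fun u => ?_)
  rw [norm_mul]
  exact mul_le_mul_of_nonneg_left (hM _) (norm_nonneg _)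

lemma continuousWithinAt_Ici_expBSplineOne (a : ℂ) (t : ℝ) :
    ContinuousWithinAt (expBSplineOne a) (Set.Ici t) t := by
  have hc : Continuous (fun t : ℝ => Complex.exp (a * (t : ℂ))) := by fun_prop
  by_cases ht : t ∈ Set.Ico (0 : ℝ) 1
  · refine hc.continuousWithinAt.congr_of_eventuallyEq ?_ (Set.indicator_of_mem ht _)
    filter_upwards [Ico_mem_nhdsGE ht.2] with s hs
    have hs' : s ∈ Set.Ico (0 : ℝ) 1 := ⟨ht.1.trans hs.1, hs.2⟩
    exact Set.indicator_of_mem hs' _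
  · refine (continuousWithinAt_const (b := (0 : ℂ))).congr_of_eventuallyEq ?_
      (Set.indicator_of_notMem ht _)
    rcases lt_or_ge t 0 with h | h
    · filter_upwards [Ico_mem_nhdsGE h] with s hs
      exact Set.indicator_of_notMem (fun h' : s ∈ Set.Ico (0 : ℝ) 1 => hs.2.not_ge h'.1) _
    · filter_upwards [self_mem_nhdsWithin] with s hs
      exact Set.indicator_of_notMem
        (fun h' : s ∈ Set.Ico (0 : ℝ) 1 => ht ⟨h, lt_of_le_of_lt hs h'.2⟩) _

lemma norm_expBSplineOne_le (a : ℂ) (t : ℝ) : ‖expBSplineOne a t‖ ≤ Real.exp |a.re| := by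
  by_cases ht : t ∈ Set.Ico (0 : ℝ) 1
  · rw [expBSplineOne, Set.indicator_of_mem ht, Complex.norm_exp, Real.exp_le_exp]
    have : (a * (t : ℂ)).re = a.re * t := by simp
    rw [this]
    calc a.re * t ≤ |a.re| * t := mul_le_mul_of_nonneg_right (le_abs_self _) ht.1
      _ ≤ |a.re| := mul_le_of_le_one_right (abs_nonneg _) ht.2.le
  · rw [expBSplineOne, Set.indicator_of_notMem ht, norm_zero]
    positivity

lemma exists_norm_causalExpBSpline_le (α : List ℂ) :
    ∃ M : ℝ, ∀ t, ‖causalExpBSpline α t‖ ≤ M := by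
  induction α using causalExpBSpline.induct with
  | case1 => exact ⟨0, fun t => by simp [causalExpBSpline]⟩
  | case2 a => exact ⟨_, norm_expBSplineOne_le a⟩
  | case3 a b l ih =>
    obtain ⟨M, hM⟩ := ih
    exact ⟨_, norm_convolution_mul_le (integrable_expBSplineOne a) hM⟩

lemma continuousWithinAt_Ici_causalExpBSpline (α : List ℂ) :
    ∀ t, ContinuousWithinAt (causalExpBSpline α) (Set.Ici t) t := by
  induction α using causalExpBSpline.induct with
  | case1 => exact fun t => continuousWithinAt_const
  | case2 a => exact continuousWithinAt_Ici_expBSplineOne a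
  | case3 a b l ih =>
    obtain ⟨M, hM⟩ := exists_norm_causalExpBSpline_le (b :: l)
    exact continuousWithinAt_Ici_convolution (integrable_expBSplineOne a)
      (integrable_causalExpBSpline (b :: l)).aestronglyMeasurable hM ih

lemma causalExpBSpline_eq_zero (α : List ℂ) :
    ∀ t, t ∉ Set.Ico (0 : ℝ) α.length → causalExpBSpline α t = 0 := by
  induction α using causalExpBSpline.induct with
  | case1 => exact fun t _ => rfl
  | case2 a =>
    intro t ht
    rw [List.length_singleton, Nat.cast_one] at ht
    rw [causalExpBSpline, expBSplineOne]
    exact Set.indicator_of_notMem ht _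
  | case3 a b l ih =>
    intro t ht
    simp only [causalExpBSpline, convolution, ContinuousLinearMap.mul_apply']
    refine integral_eq_zero_of_ae (Filter.Eventually.of_forall fun u => ?_)
    by_cases hu : u ∈ Set.Ico (0 : ℝ) 1
    · have : t - u ∉ Set.Ico (0 : ℝ) ((b :: l).length : ℝ) := by
        rintro ⟨h1, h2⟩
        refine ht ⟨by linarith [hu.1], ?_⟩
        simp only [List.length_cons, Nat.cast_add, Nat.cast_one] at h2 ⊢
        linarith [hu.2]
      simp [ih _ this]
    · simp [expBSplineOne, Set.indicator_of_notMem hu]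

/-- The properties of a function `β` on which the Riesz basis property of interpolatory generators
rests: it is integrable, bounded by `M`, right-continuous everywhere, and zero outside
`[-R, R]`. -/
structure IsRightContinuousBump (β : ℝ → ℂ) (M R : ℝ) : Prop where
  integrable : Integrable β
  norm_le : ∀ t, ‖β t‖ ≤ M
  eq_zero : ∀ t, R < |t| → β t = 0
  right_cont : ∀ t, ContinuousWithinAt β (Set.Ici t) t

lemma exists_isRightContinuousBump_expBSpline (α : List ℂ) :
    ∃ M R : ℝ, 0 ≤ R ∧ IsRightContinuousBump (expBSpline α) M R := by
  obtain ⟨M, hM⟩ := exists_norm_causalExpBSpline_le α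
  refine ⟨M, (α.length : ℝ) / 2, by positivity,
    (integrable_causalExpBSpline α).comp_add_right _, fun t => hM _, fun t ht => ?_, fun t => ?_⟩
  · refine causalExpBSpline_eq_zero α _ fun h => ht.not_ge (abs_le.2 ⟨?_, ?_⟩)
    · linarith [h.1]
    · linarith [h.2]
  · exact (continuousWithinAt_Ici_causalExpBSpline α (t + (α.length : ℝ) / 2)).comp
      (f := fun s : ℝ => s + (α.length : ℝ) / 2) (s := Set.Ici t) (by fun_prop)
      fun s hs => add_le_add_left (Set.mem_Ici.1 hs) _

/-! ### Point evaluation on finite-dimensional spaces -/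

/-- A function that is right-continuous at `0` and vanishes almost everywhere on `[0, 1)` vanishes
at `0`. -/
lemma eq_zero_of_ae_eq_zero_of_continuousWithinAt {g : ℝ → ℂ}
    (hr : ContinuousWithinAt g (Set.Ici 0) 0)
    (h0 : g =ᵐ[volume.restrict (Set.Ico 0 1)] 0) : g 0 = 0 := by
  by_contra hne
  have h1 : ∀ᶠ t in nhdsWithin (0 : ℝ) (Set.Ici 0), g t ≠ 0 := hr.eventually_ne hne
  obtain ⟨ε, hε, hsub⟩ := (mem_nhdsGE_iff_exists_Ico_subset).1 h1
  have h2 : volume (Set.Ico (0 : ℝ) (min ε 1)) = 0 := by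
    have h3 := ae_iff.1 ((ae_restrict_iff' measurableSet_Ico).1 h0)
    refine measure_mono_null (fun t ht => ?_) h3
    exact fun h => hsub ⟨ht.1, ht.2.trans_le (min_le_left _ _)⟩ (h ⟨ht.1, ht.2.trans_le (min_le_right _ _)⟩)
  rw [Real.volume_Ico, ENNReal.ofReal_eq_zero, sub_zero] at h2
  exact absurd h2 (not_le.2 (lt_min hε one_pos))

lemma enorm_toLp_sq {μ : Measure ℝ} {f : ℝ → ℂ} (hf : MemLp f 2 μ) :
    ‖hf.toLp f‖ₑ ^ 2 = ∫⁻ t, ‖f t‖ₑ ^ 2 ∂μ := by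
  rw [Lp.enorm_toLp]
  have := eLpNorm_nnreal_pow_eq_lintegral (f := f) (μ := μ) (p := 2) (by norm_num)
  simpa using this

/-- All norms on a finite-dimensional space being equivalent, evaluation at `0` is bounded by the
`L²`-norm on `[0, 1)`: that norm vanishes only on functions that vanish at `0`. -/
lemma exists_enorm_apply_zero_sq_le (V : Submodule ℂ (ℝ → ℂ)) [FiniteDimensional ℂ V]
    (hV : ∀ g ∈ V, MemLp g 2 (volume.restrict (Set.Ico 0 1)))
    (hr : ∀ g ∈ V, ContinuousWithinAt g (Set.Ici 0) 0) :
    ∃ C : NNReal, ∀ g ∈ V, ‖g 0‖ₑ ^ 2 ≤ C * ∫⁻ t in Set.Ico 0 1, ‖g t‖ₑ ^ 2 := by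
  let T : V →ₗ[ℂ] Lp ℂ 2 (volume.restrict (Set.Ico (0 : ℝ) 1)) :=
    { toFun := fun g => (hV g g.2).toLp g
      map_add' := fun g h => MemLp.toLp_add (hV g g.2) (hV h h.2)
      map_smul' := fun c g => MemLp.toLp_const_smul c (hV g g.2) }
  let ev : V →ₗ[ℂ] ℂ := (LinearMap.proj (0 : ℝ)).comp V.subtype
  -- Evaluation at `0` factors through the range of `T`, where it is automatically continuous.
  obtain ⟨σ, hσ⟩ := T.rangeRestrict.exists_rightInverse_of_surjective T.range_rangeRestrict
  let L := LinearMap.toContinuousLinearMap (ev.comp σ)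
  refine ⟨‖L‖₊ ^ 2, fun g hg => ?_⟩
  have hker : ∀ h : V, T h = 0 → ev h = 0 := by
    intro h hh
    refine eq_zero_of_ae_eq_zero_of_continuousWithinAt (hr h h.2) ?_
    have h2 : (hV h h.2).toLp (h : ℝ → ℂ) = 0 := hh
    exact (MemLp.toLp_eq_toLp_iff (hV h h.2) MemLp.zero).1 h2
  have hL : L (T.rangeRestrict ⟨g, hg⟩) = g 0 := by
    have h1 : T (σ (T.rangeRestrict ⟨g, hg⟩) - ⟨g, hg⟩) = 0 := by
      have h2 := congrArg Subtype.val (LinearMap.congr_fun hσ (T.rangeRestrict ⟨g, hg⟩))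
      rw [map_sub, sub_eq_zero]
      exact h2
    have h3 := hker _ h1
    rw [map_sub, sub_eq_zero] at h3
    exact h3
  have h4 : ‖g 0‖ₑ ≤ ‖L‖₊ * ‖(hV g hg).toLp g‖ₑ := by
    rw [← hL]
    exact L.le_opENorm (T.rangeRestrict ⟨g, hg⟩)
  calc ‖g 0‖ₑ ^ 2 ≤ (‖L‖₊ * ‖(hV g hg).toLp g‖ₑ) ^ 2 := by gcongr
    _ = _ := by rw [mul_pow, enorm_toLp_sq]; push_cast; rfl

/-! ### Passing from finite sums to square-summable coefficients -/

/-- Two-sided `ℓ²` bounds on finite linear combinations extend to all of `ℓ²`. -/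
lemma exists_hasSum_and_norm_le {E : Type*} [NormedAddCommGroup E] [NormedSpace ℂ E]
    [CompleteSpace E] {Φ : ℤ → E} {A B : ℝ} (hA : 0 ≤ A) (hB : 0 ≤ B)
    (hlow : ∀ (S : Finset ℤ) (c : ℤ → ℂ),
      A ^ 2 * ∑ n ∈ S, ‖c n‖ ^ 2 ≤ ‖∑ n ∈ S, c n • Φ n‖ ^ 2)
    (hup : ∀ (S : Finset ℤ) (c : ℤ → ℂ),
      ‖∑ n ∈ S, c n • Φ n‖ ^ 2 ≤ B ^ 2 * ∑ n ∈ S, ‖c n‖ ^ 2)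
    (c : lp (fun _ : ℤ => ℂ) 2) :
    ∃ s : E, HasSum (fun n => c n • Φ n) s ∧ A * ‖c‖ ≤ ‖s‖ ∧ ‖s‖ ≤ B * ‖c‖ := by
  have hc : HasSum (fun n => ‖c n‖ ^ 2) (‖c‖ ^ 2) := by
    have := lp.hasSum_norm (p := 2) (by norm_num) c
    simpa using this
  have hsum : Summable fun n => c n • Φ n := by
    rw [summable_iff_vanishing_norm]
    intro ε hε
    obtain ⟨S, hS⟩ := summable_iff_vanishing_norm.1 hc.summable (ε ^ 2 / (B ^ 2 + 1))
      (by positivity)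
    refine ⟨S, fun T hT => ?_⟩
    have h1 := hS T hT
    rw [Real.norm_of_nonneg (Finset.sum_nonneg fun _ _ => by positivity),
      lt_div_iff₀ (by positivity)] at h1
    have h2 := hup T c
    have h3 : 0 ≤ ∑ n ∈ T, ‖c n‖ ^ 2 := Finset.sum_nonneg fun _ _ => by positivity
    refine lt_of_pow_lt_pow_left₀ 2 hε.le ?_
    nlinarith
  obtain ⟨s, hs⟩ := hsum
  have hs2 := (hs.norm.pow 2)
  refine ⟨s, hs, ?_, ?_⟩
  · refine (sq_le_sq₀ (by positivity) (by positivity)).1 ?_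
    rw [mul_pow]
    exact le_of_tendsto_of_tendsto' (hc.const_mul _) hs2 fun S => hlow S c
  · refine (sq_le_sq₀ (by positivity) (by positivity)).1 ?_
    rw [mul_pow]
    exact le_of_tendsto_of_tendsto' hs2 (hc.const_mul _) fun S => hup S c

/-! ### Semi-discrete convolutions -/

lemma IsRightContinuousBump.sum_norm_sub_le {β : ℝ → ℂ} {M R : ℝ}
    (hβ : IsRightContinuousBump β M R) (hR : 0 ≤ R) (S : Finset ℤ) (t : ℝ) :
    ∑ n ∈ S, ‖β (t - n)‖ ≤ (2 * R + 1) * M := by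
  have hM : 0 ≤ M := (norm_nonneg _).trans (hβ.norm_le 0)
  have h1 : ∀ n ∈ S, n ∉ Finset.Icc ⌈t - R⌉ ⌊t + R⌋ → ‖β (t - n)‖ = 0 := by
    intro n _ hn
    rw [norm_eq_zero]
    refine hβ.eq_zero _ ?_
    by_contra! h
    refine hn (Finset.mem_Icc.2 ⟨Int.ceil_le.2 ?_, Int.le_floor.2 ?_⟩)
    · linarith [(abs_le.1 h).2]
    · linarith [(abs_le.1 h).1]
  calc ∑ n ∈ S, ‖β (t - n)‖
      = ∑ n ∈ S with n ∈ Finset.Icc ⌈t - R⌉ ⌊t + R⌋, ‖β (t - n)‖ := by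
        rw [Finset.sum_filter]
        refine Finset.sum_congr rfl fun n hn => ?_
        split_ifs with h
        · rfl
        · exact h1 n hn h
    _ ≤ ∑ n ∈ Finset.Icc ⌈t - R⌉ ⌊t + R⌋, ‖β (t - n)‖ :=
        Finset.sum_le_sum_of_subset_of_nonneg
          (fun n hn => (Finset.mem_filter.1 hn).2) fun _ _ _ => norm_nonneg _
    _ ≤ (Finset.Icc ⌈t - R⌉ ⌊t + R⌋).card • M := Finset.sum_le_card_nsmul _ _ _ fun _ _ =>
        hβ.norm_le _
    _ ≤ (2 * R + 1) * M := by
        rw [nsmul_eq_mul]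
        refine mul_le_mul_of_nonneg_right ?_ hM
        rw [Int.card_Icc]
        have h2 : (((⌊t + R⌋ + 1 - ⌈t - R⌉).toNat : ℤ) : ℝ) ≤ 2 * R + 1 := by
          rw [Int.toNat_eq_max]
          push_cast
          refine max_le ?_ (by linarith)
          linarith [Int.floor_le (t + R), Int.le_ceil (t - R)]
        exact_mod_cast h2

section Semidiscrete

variable {β : ℝ → ℂ} {M R : ℝ} {lam : ℤ → ℂ}

lemma IsRightContinuousBump.summable_norm_mul (hβ : IsRightContinuousBump β M R)
    (hlam : Summable fun n => ‖lam n‖) (x : ℤ → ℝ) : Summable fun n => ‖lam n * β (x n)‖ := by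
  refine Summable.of_nonneg_of_le (fun _ => norm_nonneg _) (fun n => ?_) (hlam.mul_right M)
  rw [norm_mul]
  exact mul_le_mul_of_nonneg_left (hβ.norm_le _) (norm_nonneg _)

/-- The integer translates of the generator are absolutely summable, uniformly in the point. -/
lemma IsRightContinuousBump.sum_norm_tsum_le (hβ : IsRightContinuousBump β M R) (hR : 0 ≤ R)
    (hlam : Summable fun n => ‖lam n‖) (S : Finset ℤ) (t : ℝ) :
    ∑ n ∈ S, ‖∑' l : ℤ, lam l * β (t - n - l / 2)‖ ≤ (∑' l, ‖lam l‖) * ((2 * R + 1) * M) := by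
  have hs := fun n : ℤ => hβ.summable_norm_mul hlam fun l : ℤ => t - n - (l : ℝ) / 2
  calc ∑ n ∈ S, ‖∑' l : ℤ, lam l * β (t - n - l / 2)‖
      ≤ ∑ n ∈ S, ∑' l : ℤ, ‖lam l * β (t - n - l / 2)‖ :=
        Finset.sum_le_sum fun n _ => norm_tsum_le_tsum_norm (hs n)
    _ = ∑' l : ℤ, ∑ n ∈ S, ‖lam l * β (t - n - l / 2)‖ :=
        (Summable.tsum_finsetSum fun n _ => hs n).symm
    _ ≤ ∑' l : ℤ, ‖lam l‖ * ((2 * R + 1) * M) := by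
        refine Summable.tsum_le_tsum (fun l => ?_) (summable_sum fun n _ => hs n)
          (hlam.mul_right _)
        simp_rw [norm_mul, ← Finset.mul_sum]
        refine mul_le_mul_of_nonneg_left ?_ (norm_nonneg _)
        simpa only [sub_right_comm] using hβ.sum_norm_sub_le hR S (t - l / 2)
    _ = _ := tsum_mul_right

lemma IsRightContinuousBump.integrable_tsum (hβ : IsRightContinuousBump β M R)
    (hlam : Summable fun n => ‖lam n‖) :
    Integrable fun t : ℝ => ∑' l : ℤ, lam l * β (t - l / 2) := by
  have hi : ∀ l : ℤ, Integrable fun t : ℝ => lam l * β (t - l / 2) := fun l =>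
    (hβ.integrable.comp_sub_right ((l : ℝ) / 2)).const_mul _
  refine ⟨?_, ?_⟩
  · refine aestronglyMeasurable_of_tendsto_ae Filter.atTop
      (f := fun (S : Finset ℤ) (t : ℝ) => ∑ l ∈ S, lam l * β (t - l / 2)) (fun S => ?_) ?_
    · exact (integrable_finsetSum S fun l _ => hi l).aestronglyMeasurable
    · exact Filter.Eventually.of_forall fun t =>
        (hβ.summable_norm_mul hlam fun l : ℤ => t - (l : ℝ) / 2).of_norm.hasSum
  · refine lt_of_le_of_lt (lintegral_mono fun t => enorm_tsum_le_tsum_enorm) ?_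
    rw [lintegral_tsum fun l => (hi l).aestronglyMeasurable.enorm]
    have h1 : ∀ l : ℤ, ∫⁻ t : ℝ, ‖lam l * β (t - l / 2)‖ₑ = ‖lam l‖ₑ * ∫⁻ t, ‖β t‖ₑ := by
      intro l
      simp_rw [enorm_mul]
      rw [lintegral_const_mul' _ _ enorm_ne_top,
        lintegral_sub_right_eq_self (fun t => ‖β t‖ₑ) ((l : ℝ) / 2)]
    simp_rw [h1]
    rw [ENNReal.tsum_mul_right]
    refine ENNReal.mul_lt_top ?_ hβ.integrable.2
    rw [lt_top_iff_ne_top]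
    exact ENNReal.tsum_coe_ne_top_iff_summable.2 (NNReal.summable_coe.1 hlam)

/-- On every interval `[k, k + 1)` the generator is a linear combination of the same finitely many
functions `β (· + j / 2)`, because the other half-integer shifts of `β` vanish on `[0, 1)`. -/
lemma IsRightContinuousBump.exists_mem_span_eqOn (hβ : IsRightContinuousBump β M R) (k : ℤ) :
    ∃ g ∈ Submodule.span ℂ ((fun (j : ℤ) (t : ℝ) => β (t + j / 2)) ''
        (Finset.Icc (-⌈2 * (R + 1)⌉) ⌈2 * (R + 1)⌉ : Finset ℤ)),
      ∀ t ∈ Set.Ico (0 : ℝ) 1, ∑' l : ℤ, lam l * β (k + t - l / 2) = g t := by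
  refine ⟨∑ j ∈ Finset.Icc (-⌈2 * (R + 1)⌉) ⌈2 * (R + 1)⌉,
    lam (2 * k - j) • fun t : ℝ => β (t + j / 2), ?_, fun t ht => ?_⟩
  · exact Submodule.sum_mem _ fun j hj => Submodule.smul_mem _ _
      (Submodule.subset_span ⟨j, hj, rfl⟩)
  -- Substituting `l = 2 k - j` turns the argument `k + t - l / 2` into `t + j / 2`.
  · rw [← (Equiv.subLeft (2 * k)).tsum_eq, tsum_eq_sum
      (s := Finset.Icc (-⌈2 * (R + 1)⌉) ⌈2 * (R + 1)⌉)]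
    · rw [Finset.sum_apply]
      refine Finset.sum_congr rfl fun j _ => ?_
      simp only [Equiv.subLeft_apply, Pi.smul_apply, smul_eq_mul]
      congr 2
      push_cast
      ring
    · intro j hj
      rw [hβ.eq_zero, mul_zero]
      by_contra! h
      refine hj (Finset.mem_Icc.2 ?_)
      have h2 := abs_le.1 h
      simp only [Equiv.subLeft_apply] at h2
      push_cast at h2
      have h3 := Int.le_ceil (2 * (R + 1))
      constructor
      · have : ((-⌈2 * (R + 1)⌉ : ℤ) : ℝ) ≤ j := by push_cast; linarith [h2.1, ht.1, ht.2]
        exact_mod_cast this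
      · have : (j : ℝ) ≤ (⌈2 * (R + 1)⌉ : ℤ) := by linarith [h2.2, ht.1, ht.2]
        exact_mod_cast this

end Semidiscrete

/-! ### Bounds for finite combinations of integer translates -/

/-- Upper bound, by the Cauchy-Schwarz inequality with weights `‖φ (t - n)‖`. -/
lemma lintegral_enorm_sum_sq_le {φ : ℝ → ℂ} {P : ℝ} (hφ : Integrable φ)
    (hP : ∀ (S : Finset ℤ) (t : ℝ), ∑ n ∈ S, ‖φ (t - n)‖ ≤ P) (S : Finset ℤ) (c : ℤ → ℂ) :
    ∫⁻ t, ‖∑ n ∈ S, c n * φ (t - n)‖ₑ ^ 2 ≤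
      ENNReal.ofReal (P * (∫ t, ‖φ t‖) * ∑ n ∈ S, ‖c n‖ ^ 2) := by
  have hP0 : 0 ≤ P := by simpa using hP ∅ 0
  have hi : ∀ n : ℤ, Integrable fun t : ℝ => ‖c n‖ ^ 2 * ‖φ (t - n)‖ := fun n =>
    (hφ.comp_sub_right (n : ℝ)).norm.const_mul _
  have hpt : ∀ t : ℝ, ‖∑ n ∈ S, c n * φ (t - n)‖ ^ 2 ≤
      P * ∑ n ∈ S, ‖c n‖ ^ 2 * ‖φ (t - n)‖ := by
    intro t
    calc ‖∑ n ∈ S, c n * φ (t - n)‖ ^ 2 ≤ (∑ n ∈ S, ‖c n‖ * ‖φ (t - n)‖) ^ 2 := by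
          gcongr
          exact (norm_sum_le _ _).trans_eq (Finset.sum_congr rfl fun n _ => norm_mul _ _)
      _ ≤ (∑ n ∈ S, ‖φ (t - n)‖) * ∑ n ∈ S, ‖c n‖ ^ 2 * ‖φ (t - n)‖ :=
          Finset.sum_sq_le_sum_mul_sum_of_sq_le_mul S (fun _ _ => norm_nonneg _)
            (fun _ _ => by positivity) fun n _ => le_of_eq (by ring)
      _ ≤ _ := mul_le_mul_of_nonneg_right (hP S t)
          (Finset.sum_nonneg fun _ _ => by positivity)
  have hI : ∫ t : ℝ, P * ∑ n ∈ S, ‖c n‖ ^ 2 * ‖φ (t - n)‖ =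
      P * (∫ t, ‖φ t‖) * ∑ n ∈ S, ‖c n‖ ^ 2 := by
    rw [integral_const_mul, integral_finsetSum _ fun n _ => hi n]
    have hshift : ∀ n : ℤ, ∫ t : ℝ, ‖φ (t - n)‖ = ∫ t, ‖φ t‖ := fun n =>
      integral_sub_right_eq_self (fun t => ‖φ t‖) (n : ℝ)
    simp_rw [integral_const_mul, hshift]
    rw [← Finset.sum_mul]
    ring
  rw [← hI, ofReal_integral_eq_lintegral_ofReal
    ((integrable_finsetSum S fun n _ => hi n).const_mul P) (Filter.Eventually.of_forall fun t =>
      mul_nonneg hP0 (Finset.sum_nonneg fun _ _ => by positivity))]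
  refine lintegral_mono fun t => ?_
  rw [← ofReal_norm, ← ENNReal.ofReal_pow (norm_nonneg _)]
  exact ENNReal.ofReal_le_ofReal (hpt t)

/-- Lower bound: the coefficient `c k` is the value at `k` of the combination, and its square is
dominated by the energy of the combination on `[k, k + 1)`. -/
lemma sum_enorm_sq_le_lintegral {φ : ℝ → ℂ} (hφ : IsInterpolatory φ) {C : NNReal}
    {V : Submodule ℂ (ℝ → ℂ)}
    (hV : ∀ g ∈ V, ‖g 0‖ₑ ^ 2 ≤ C * ∫⁻ t in Set.Ico 0 1, ‖g t‖ₑ ^ 2)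
    (hloc : ∀ k : ℤ, ∃ g ∈ V, ∀ t ∈ Set.Ico (0 : ℝ) 1, φ (k + t) = g t)
    (S : Finset ℤ) (c : ℤ → ℂ) :
    ∑ n ∈ S, ‖c n‖ₑ ^ 2 ≤ C * ∫⁻ t, ‖∑ n ∈ S, c n * φ (t - n)‖ₑ ^ 2 := by
  choose g hgV hg using hloc
  set f : ℝ → ℂ := fun t => ∑ n ∈ S, c n * φ (t - n) with hf
  have hstep : ∀ k ∈ S, ‖c k‖ₑ ^ 2 ≤
      C * ∫⁻ t in Set.Ico (k : ℝ) (k + 1), ‖f t‖ₑ ^ 2 := by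
    intro k hk
    have hG : ∀ t ∈ Set.Ico (0 : ℝ) 1, f (k + t) = (∑ n ∈ S, c n • g (k - n)) t := by
      intro t ht
      rw [Finset.sum_apply]
      refine Finset.sum_congr rfl fun n _ => ?_
      rw [Pi.smul_apply, smul_eq_mul, ← hg _ t ht]
      congr 2
      push_cast
      ring
    have h0 : (∑ n ∈ S, c n • g (k - n)) 0 = c k := by
      rw [← hG 0 (by simp), add_zero, hf]
      dsimp only
      rw [Finset.sum_eq_single_of_mem k hk]
      · have := hφ 0
        simp_all
      · intro n _ hn
        have := hφ (k - n)
        rw [if_neg (sub_ne_zero.2 hn.symm)] at this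
        push_cast at this
        rw [this, mul_zero]
    have h1 := hV _ (Submodule.sum_mem V fun n (_ : n ∈ S) => V.smul_mem (c n) (hgV (k - n)))
    rw [h0] at h1
    refine h1.trans_eq ?_
    congr 1
    rw [← lintegral_indicator measurableSet_Ico, ← lintegral_indicator measurableSet_Ico,
      ← lintegral_add_left_eq_self (Set.indicator (Set.Ico (k : ℝ) (k + 1)) _) (k : ℝ)]
    refine lintegral_congr fun t => ?_
    by_cases ht : t ∈ Set.Ico (0 : ℝ) 1
    · rw [Set.indicator_of_mem ht, Set.indicator_of_mem (by simpa using ht), hG t ht]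
    · rw [Set.indicator_of_notMem ht, Set.indicator_of_notMem (by simpa using ht)]
  refine (Finset.sum_le_sum hstep).trans ?_
  rw [← Finset.mul_sum]
  gcongr
  rw [← lintegral_biUnion_finset (s := S) (t := fun k : ℤ => Set.Ico (k : ℝ) (k + 1))
    ((Set.pairwise_disjoint_Ico_intCast ℝ).set_pairwise _) (fun _ _ => measurableSet_Ico)]
  exact setLIntegral_le_lintegral _ _

lemma exists_sum_smul_toLp_eq {μ : Measure ℝ} {φ : ℤ → ℝ → ℂ} (h : ∀ n, MemLp (φ n) 2 μ)
    (S : Finset ℤ) (c : ℤ → ℂ) :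
    ∃ hf : MemLp (fun t => ∑ n ∈ S, c n * φ n t) 2 μ,
      ∑ n ∈ S, c n • (h n).toLp (φ n) = hf.toLp _ := by
  refine ⟨memLp_finsetSum S fun n _ => (h n).const_mul (c n), ?_⟩
  refine Lp.ext ?_
  refine (Lp.coeFn_finsetSum _ _).trans ?_
  refine Filter.EventuallyEq.trans ?_ (MemLp.coeFn_toLp _).symm
  filter_upwards [ae_all_iff.2 fun n => Lp.coeFn_smul (c n) ((h n).toLp (φ n)),
    ae_all_iff.2 fun n => (h n).coeFn_toLp] with t h1 h2
  rw [Finset.sum_apply]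
  refine Finset.sum_congr rfl fun n _ => ?_
  rw [h1 n, Pi.smul_apply, h2 n, smul_eq_mul]

/-- An interpolatory generator `∑ₗ λ[l] β (· - l / 2)` with `λ ∈ ℓ₁` has integer translates that
form a Riesz basis. -/
lemma IsRightContinuousBump.isRieszBasis {β : ℝ → ℂ} {M R : ℝ} {lam : ℤ → ℂ}
    (hβ : IsRightContinuousBump β M R) (hR : 0 ≤ R) (hlam : Summable fun n => ‖lam n‖)
    {φ : ℝ → ℂ} (hdef : ∀ t, φ t = ∑' l : ℤ, lam l * β (t - l / 2)) (hφ : IsInterpolatory φ) :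
    IsRieszBasis fun (n : ℤ) (t : ℝ) => φ (t - n) := by
  have hint : Integrable φ := by
    rw [funext hdef]
    exact hβ.integrable_tsum hlam
  obtain ⟨P, hP⟩ : ∃ P, ∀ (S : Finset ℤ) (t : ℝ), ∑ n ∈ S, ‖φ (t - n)‖ ≤ P := by
    simp_rw [hdef]
    exact ⟨_, hβ.sum_norm_tsum_le hR hlam⟩
  have hP0 : 0 ≤ P := by simpa using hP ∅ 0
  have hL2 : ∀ ψ : ℝ → ℂ, Integrable ψ → ∀ K, (∀ t, ‖ψ t‖ ≤ K) → MemLp ψ 2 := by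
    intro ψ hψ K hK
    rw [memLp_two_iff_integrable_sq_norm hψ.aestronglyMeasurable]
    refine (hψ.norm.const_mul K).mono' (hψ.aestronglyMeasurable.norm.pow 2)
      (Filter.Eventually.of_forall fun t => ?_)
    rw [Real.norm_of_nonneg (by positivity), sq]
    exact mul_le_mul_of_nonneg_right (hK t) (norm_nonneg _)
  have hmem : ∀ n : ℤ, MemLp (fun t : ℝ => φ (t - n)) 2 := fun n =>
    hL2 _ (hint.comp_sub_right _) P fun t => by simpa using hP {n} t
  set V := Submodule.span ℂ ((fun (j : ℤ) (t : ℝ) => β (t + j / 2)) ''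
    (Finset.Icc (-⌈2 * (R + 1)⌉) ⌈2 * (R + 1)⌉ : Finset ℤ)) with hVdef
  have : FiniteDimensional ℂ V :=
    FiniteDimensional.span_of_finite ℂ ((Finset.finite_toSet _).image _)
  obtain ⟨C, hC⟩ := exists_enorm_apply_zero_sq_le V
    (fun g hg => by
      refine MemLp.restrict _ ?_
      induction hg using Submodule.span_induction with
      | mem x hx =>
        obtain ⟨j, -, rfl⟩ := hx
        exact hL2 _ (hβ.integrable.comp_add_right _) M fun t => hβ.norm_le _
      | zero => exact MemLp.zero
      | add x y _ _ hx hy => exact hx.add hy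
      | smul a x _ hx => exact hx.const_smul a)
    (fun g hg => by
      induction hg using Submodule.span_induction with
      | mem x hx =>
        obtain ⟨j, -, rfl⟩ := hx
        exact (hβ.right_cont (0 + (j : ℝ) / 2)).comp (f := fun t : ℝ => t + (j : ℝ) / 2)
          (s := Set.Ici 0) (by fun_prop) fun s hs => add_le_add_left (Set.mem_Ici.1 hs) _
      | zero => exact continuousWithinAt_const
      | add x y _ _ hx hy => exact hx.add hy
      | smul a x _ hx => exact hx.const_smul a)
  have hloc : ∀ k : ℤ, ∃ g ∈ V, ∀ t ∈ Set.Ico (0 : ℝ) 1, φ (k + t) = g t := by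
    simp_rw [hdef]
    exact hβ.exists_mem_span_eqOn
  set K : ℝ := P * ∫ t, ‖φ t‖ with hK
  have hK0 : 0 ≤ K := mul_nonneg hP0 (integral_nonneg fun _ => norm_nonneg _)
  have hsq : ∀ z : ℂ, ‖z‖ₑ ^ 2 = ENNReal.ofReal (‖z‖ ^ 2) := fun z => by
    rw [← ofReal_norm, ENNReal.ofReal_pow (norm_nonneg _)]
  -- The summands `1` keep the constants positive and finite.
  refine ⟨hmem, √(1 / (C + 1)), √(K + 1), by positivity, by positivity,
    exists_hasSum_and_norm_le (Real.sqrt_nonneg _) (Real.sqrt_nonneg _) ?_ ?_⟩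
  · intro S c
    obtain ⟨hf, hfeq⟩ := exists_sum_smul_toLp_eq hmem S c
    have h1 := sum_enorm_sq_le_lintegral hφ hC hloc S c
    rw [← enorm_toLp_sq hf, ← hfeq, ← ofReal_norm,
      ← ENNReal.ofReal_pow (norm_nonneg _), ← ENNReal.ofReal_coe_nnreal,
      ← ENNReal.ofReal_mul C.coe_nonneg] at h1
    simp_rw [hsq] at h1
    rw [← ENNReal.ofReal_sum_of_nonneg fun _ _ => by positivity,
      ENNReal.ofReal_le_ofReal_iff (by positivity)] at h1
    rw [Real.sq_sqrt (by positivity), one_div, inv_mul_le_iff₀ (by positivity)]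
    nlinarith [sq_nonneg ‖∑ n ∈ S, c n • (hmem n).toLp (fun t : ℝ => φ (t - n))‖]
  · intro S c
    obtain ⟨hf, hfeq⟩ := exists_sum_smul_toLp_eq hmem S c
    have h1 := lintegral_enorm_sum_sq_le hint hP S c
    have h2 : 0 ≤ ∑ n ∈ S, ‖c n‖ ^ 2 := Finset.sum_nonneg fun _ _ => by positivity
    rw [← enorm_toLp_sq hf, ← hfeq, ← ofReal_norm,
      ← ENNReal.ofReal_pow (norm_nonneg _), ENNReal.ofReal_le_ofReal_iff (by positivity)] at h1
    rw [Real.sq_sqrt (by positivity)]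
    linarith

theorem proposition1 (α : List ℂ) (hα : α ≠ [])
    (hroots : ∀ a ∈ α, ∀ b ∈ α, a.re = 0 → b.re = 0 → a ≠ b →
      ∀ k : ℤ, a - b ≠ 2 * (k : ℂ) * (Real.pi : ℂ) * Complex.I)
    (lam : lp (fun _ : ℤ => ℂ) 1)
    (hinterp : IsInterpolatory (generator (fun n => lam n) α)) :
    IsRieszBasis (fun (n : ℤ) (t : ℝ) => generator (fun n => lam n) α (t - (n : ℝ))) := by
  obtain ⟨M, R, hR, hβ⟩ := exists_isRightContinuousBump_expBSpline α
  have hlam : Summable fun n => ‖lam n‖ := by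
    simpa using (lp.hasSum_norm (p := 1) (by norm_num) lam).summable
  exact hβ.isRieszBasis hR hlam (fun _ => rfl) hinterp
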